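/- Let $k$ be an algebraically closed field, let $d,n$ be positive integers, and let $\mathcal M$ be a loop-free matroid of rank $d$ on $\{1,\dots,n\}$ that has no pairs of distinct parallel elements (i.e. no two-element circuits). Let $X\subset \mathbb A^n_k=\operatorname{Spec} k[x_1,\dots,x_n]$ be a $d$-dimensional linear subspace of combinatorial type $\mathcal M$, i.e. such that a set $I\subset\{1,\dots,n\}$ is independent in $\mathcal M$ if and only if the restrictions $x_i|_X$, $i\in I$, are linearly independent. Let $F$ be the scheme-theoretic intersection of $X$ with the hypersurface $x_1\cdots x_n=1$, regarded as a closed subscheme of the torus $\mathbb G_{m,k}^n=\operatorname{Spec} k[x_1^{\pm1},\dots,x_n^{\pm1}]$, and let $I_F$ be the ideal of $F$ in $k[x_1^{\pm1},\dots,x_n^{\pm1}]$. For $w\in\mathbb R^n$ and a Laurent polynomial $f=\sum_u a_u x^u$, let $\operatorname{in}_w f$ be the sum of the terms $a_u x^u$ with $a_u\neq 0$ for which $\langle w,u\rangle$ is minimal, and let $\operatorname{in}_w F\subset\mathbb G_{m,k}^n$ be the closed subscheme defined by the ideal generated by $\{\operatorname{in}_w f : f\in I_F\}$. Then for every $w\in\mathbb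 R^n$, the initial degeneration $\operatorname{in}_w F$ is irreducible whenever it is nonempty; that is, $\operatorname{in}_w F$ is either empty or an irreducible topological space. -/

import Mathlib

universe u

noncomputable section

namespace MilnorArrangement

/-- Two elements of a matroid are parallel if they are nonloops that are equal or form a
two-element circuit. -/
def Parallel {α : Type*} (M : Matroid α) (i j : α) : Prop :=
  M.IsNonloop i ∧ (i = j ∨ M.IsCircuit {i, j})

/-- The `k`-points of the Grassmannian: the `d`-dimensional linear subspaces of `k ^ n`. -/
def Gr (k : Type u) [Field k] (d n : ℕ) : Set (Submodule k (Fin n → k)) :=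
  {A | Module.finrank k A = d}

/-- The restriction to the subspace `A` of the `i`-th coordinate function. -/
def coord {k : Type u} [Field k] {n : ℕ} (A : Submodule k (Fin n → k)) (i : Fin n) :
    A →ₗ[k] k :=
  (LinearMap.proj i : (Fin n → k) →ₗ[k] k).domRestrict A

/-- The `k`-points of the realization space of `M`: the `d`-dimensional linear subspaces of
`k ^ n` with combinatorial type `M`. -/
def GrMatroid (k : Type u) [Field k] (d : ℕ) {n : ℕ} (M : Matroid (Fin n)) :
    Set (Submodule k (Fin n → k)) :=
  {A | A ∈ Gr k d n ∧ ∀ I : Set (Fin n), M.Indep I ↔ LinearIndepOn k (coord A) I}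

/-- The ideal of `k[x₁, …, xₙ]` that defines the linear subspace `X_A` of affine space: it is
generated by the linear forms that vanish on `A`. -/
def linearIdeal {k : Type u} [Field k] {n : ℕ} (A : Submodule k (Fin n → k)) :
    Ideal (MvPolynomial (Fin n) k) :=
  Ideal.span {L | ∃ a : Fin n → k, (∀ v ∈ A, ∑ i, a i * v i = 0) ∧
    L = ∑ i, MvPolynomial.C (a i) * MvPolynomial.X i}

/-- The ideal of `k[x₁, …, xₙ]` that defines `F_A`, the scheme-theoretic intersection of `X_A`
with the hypersurface `x₁ ⋯ xₙ = 1`. -/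
def milnorIdeal {k : Type u} [Field k] {n : ℕ} (A : Submodule k (Fin n → k)) :
    Ideal (MvPolynomial (Fin n) k) :=
  linearIdeal A ⊔ Ideal.span {(∏ i, MvPolynomial.X i) - 1}

/-- The Laurent polynomial ring `k[x₁^±1, …, xₙ^±1]`. -/
abbrev Laurent (k : Type u) [Field k] (n : ℕ) : Type u :=
  AddMonoidAlgebra k (Fin n → ℤ)

/-- The inclusion of polynomials into Laurent polynomials. -/
def toLaurent (k : Type u) [Field k] (n : ℕ) :
    MvPolynomial (Fin n) k →ₐ[k] Laurent k n :=
  MvPolynomial.aeval fun i => AddMonoidAlgebra.single (Pi.single i 1) 1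

/-- The ideal that defines `F_A` as a closed subscheme of the algebraic torus. -/
def milnorTorusIdeal {k : Type u} [Field k] {n : ℕ} (A : Submodule k (Fin n → k)) :
    Ideal (Laurent k n) :=
  (milnorIdeal A).map (toLaurent k n)

/-- The `w`-weight of the monomial with exponent `u`. -/
def weight {n : ℕ} (w : Fin n → ℝ) (u : Fin n → ℤ) : ℝ :=
  ∑ i, w i * (u i : ℝ)

open Classical in
/-- The initial form `in_w f`: the sum of the terms of `f` of minimal `w`-weight. -/
def initialForm {k : Type u} [Field k] {n : ℕ} (w : Fin n → ℝ) (f : Laurent k n) :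
    Laurent k n :=
  AddMonoidAlgebra.ofCoeff
    (f.coeff.filter fun u => ∀ v ∈ f.coeff.support, weight w u ≤ weight w v)

/-- The ideal generated by the initial forms of the elements of `I`. -/
def initialIdeal {k : Type u} [Field k] {n : ℕ} (w : Fin n → ℝ) (I : Ideal (Laurent k n)) :
    Ideal (Laurent k n) :=
  Ideal.span (initialForm w '' (I : Set (Laurent k n)))

/-- The initial degeneration `in_w X` of the closed subscheme `X` of the torus defined by `I`. -/
def initialDegeneration {k : Type u} [Field k] {n : ℕ} (w : Fin n → ℝ)
    (I : Ideal (Laurent k n)) : AlgebraicGeometry.Scheme.{u} :=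
  AlgebraicGeometry.Spec (CommRingCat.of (Laurent k n ⧸ initialIdeal w I))

end MilnorArrangement

end

/-!
The initial form of `x₁ ⋯ xₙ - 1` is a unit unless `∑ i, w i = 0`. In that case choose, greedily by
decreasing weight, a basis among the coordinate functions on `A`. Every coordinate function then
expands through basis elements of weight at least its own, and the terms of weight exactly `w i` in
the expansion of `x_i` make up its leading form `ℓ_i`. If some `ℓ_i` vanishes, `x_i` lies in the
initial ideal and the degeneration is empty.

Otherwise the degeneration is the hypersurface `∏ i, ℓ_i = 1`, embedded in the torus by the `ℓ_i`.
The relations `x_i = ℓ_i` and `∏ i, x_i = 1` hold on it because they are initial forms of relations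
on `F`. For the converse, substitute `X_b t ^ w b` for the basis coordinates: the coordinate
functions become Hahn series in `t` with order `w i` and leading coefficient `ℓ_i`, and
`∏ i, x_i - 1` acquires the leading coefficient `∏ i, ℓ_i - 1`. Since the ideal of `F` maps into the
ideal generated by this series, the substitution `x_i ↦ ℓ_i` sends every initial form to a multiple
of `∏ i, ℓ_i - 1` once the `ℓ_i` are inverted.

After the substitution `x ↦ T x`, the polynomial `∏ i, ℓ_i - 1` becomes `(∏ i, ℓ_i) T ^ n - 1`, the
reverse of `T ^ n - ∏ i, ℓ_i`. The latter is Eisenstein at a basis variable `X_b` of maximal weight: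
if `X_b` divides `ℓ_i`, then `x_i` is proportional to `x_b`, so `i = b` in the absence of parallel
elements, and `X_b` divides the product exactly once.
-/

noncomputable section

namespace MilnorArrangement

section Irreducibility

variable {R : Type*} [CommRing R] [IsDomain R]

open Polynomial in
theorem irreducible_X_pow_sub_C_of_prime {p π : R} {m : ℕ} (hm : m ≠ 0) (hπ : Prime π)
    (hdvd : π ∣ p) (hsq : ¬ π ^ 2 ∣ p) : Irreducible (X ^ m - C p : R[X]) := by
  have hmonic : (X ^ m - C p).Monic := monic_X_pow_sub_C p hm
  refine irreducible_of_eisenstein_criterion (P := Ideal.span {π})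
    ((Ideal.span_singleton_prime hπ.ne_zero).2 hπ) ?_ (fun i hi => ?_) ?_ ?_ hmonic.isPrimitive
  · rw [hmonic.leadingCoeff, Ideal.mem_span_singleton]
    exact hπ.not_dvd_one
  · rw [degree_X_pow_sub_C (Nat.pos_of_ne_zero hm), Nat.cast_lt] at hi
    rw [coeff_sub, coeff_X_pow, if_neg hi.ne, zero_sub, coeff_C, Ideal.mem_span_singleton,
      dvd_neg]
    split_ifs
    · exact hdvd
    · exact dvd_zero π
  · rw [degree_X_pow_sub_C (Nat.pos_of_ne_zero hm)]
    exact_mod_cast Nat.pos_of_ne_zero hm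
  · rw [Ideal.span_singleton_pow, Ideal.mem_span_singleton]
    simpa [coeff_X_pow, hm.symm] using hsq

open Polynomial in
theorem irreducible_of_irreducible_reverse {f : R[X]} (h0 : f.coeff 0 ≠ 0)
    (hf : Irreducible f.reverse) : Irreducible f := by
  have isUnit_of_isUnit_reverse : ∀ g : R[X], g.coeff 0 ≠ 0 → IsUnit g.reverse → IsUnit g := by
    intro g hg hu
    have hdeg : g.reverse.natDegree = g.natDegree := by
      rw [reverse_natDegree, natTrailingDegree_eq_zero_of_constantCoeff_ne_zero hg, tsub_zero]
    have hC : g = C (g.coeff 0) :=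
      eq_C_of_natDegree_eq_zero (hdeg ▸ natDegree_eq_zero_of_isUnit hu)
    rw [hC] at hu ⊢
    rwa [reverse_C] at hu
  refine ⟨fun hu => hf.not_isUnit ?_, fun a b hab => ?_⟩
  · obtain ⟨r, hr, rfl⟩ := Polynomial.isUnit_iff.1 hu
    rw [reverse_C]
    exact hr.map C
  · rw [hab, mul_coeff_zero] at h0
    rw [hab, reverse_mul_of_domain] at hf
    exact (hf.isUnit_or_isUnit rfl).imp (isUnit_of_isUnit_reverse a (left_ne_zero_of_mul h0))
      (isUnit_of_isUnit_reverse b (right_ne_zero_of_mul h0))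

open Polynomial in
theorem irreducible_C_mul_X_pow_sub_one {p π : R} {m : ℕ} (hm : m ≠ 0) (hπ : Prime π)
    (hdvd : π ∣ p) (hsq : ¬ π ^ 2 ∣ p) : Irreducible (C p * X ^ m - 1 : R[X]) := by
  have hp : p ≠ 0 := by
    rintro rfl
    exact hsq (dvd_zero _)
  refine irreducible_of_irreducible_reverse (by simp [hm.symm]) ?_
  have hdeg : (C p * X ^ m - 1 : R[X]).natDegree = m := by
    rw [← C_1, natDegree_sub_C, natDegree_C_mul_X_pow m p hp]
  have hrev : (C p * X ^ m - 1 : R[X]).reverse = -(X ^ m - C p) := by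
    rw [reverse, hdeg, reflect_sub, reflect_C_mul_X_pow, reflect_one, revAt_le le_rfl]
    simp
  rw [hrev]
  exact (Associated.refl _).neg_right.irreducible
    (irreducible_X_pow_sub_C_of_prime hm hπ hdvd hsq)

end Irreducibility

section Dilate

open MvPolynomial

variable {R σ : Type*} [CommRing R]

/-- The homomorphism `p(x) ↦ p(Tx)`, which separates the homogeneous components of `p` by powers
of `T`. -/
def dilate (σ R : Type*) [CommRing R] :
    MvPolynomial σ R →ₐ[R] Polynomial (MvPolynomial σ R) :=
  aeval fun i => Polynomial.C (X i) * Polynomial.X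

theorem eval_one_dilate (p : MvPolynomial σ R) : (dilate σ R p).eval 1 = p := by
  induction p using MvPolynomial.induction_on with
  | C a => simp [dilate]
  | add p q hp hq => rw [map_add, Polynomial.eval_add, hp, hq]
  | mul_X p i hp => rw [map_mul, Polynomial.eval_mul, hp]; simp [dilate]

theorem dilate_of_isHomogeneous {p : MvPolynomial σ R} {m : ℕ} (hp : p.IsHomogeneous m) :
    dilate σ R p = Polynomial.C p * Polynomial.X ^ m := by
  have dilate_monomial : ∀ d ∈ p.support, dilate σ R (monomial d (p.coeff d)) =
      Polynomial.C (monomial d (p.coeff d)) * Polynomial.X ^ m := by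
    intro d hd
    rw [dilate, aeval_monomial, monomial_eq, hp.degree_eq_sum_deg_support hd]
    simp only [Finsupp.prod, mul_pow, Finset.prod_mul_distrib, Finset.prod_pow_eq_pow_sum,
      map_mul, map_prod, map_pow, mul_assoc]
    rfl
  conv_lhs => rw [p.as_sum]
  conv_rhs => rw [p.as_sum]
  rw [map_sum, map_sum, Finset.sum_mul]
  exact Finset.sum_congr rfl dilate_monomial

theorem irreducible_sub_one_of_isHomogeneous [IsDomain R] {p π : MvPolynomial σ R} {m : ℕ}
    (hm : m ≠ 0) (hp : p.IsHomogeneous m) (hπ : Prime π) (hdvd : π ∣ p) (hsq : ¬ π ^ 2 ∣ p) :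
    Irreducible (p - 1) := by
  have : IsLocalHom (dilate σ R) :=
    isLocalHom_of_leftInverse (Polynomial.evalRingHom 1) eval_one_dilate
  refine Irreducible.of_map (f := dilate σ R) ?_
  rw [map_sub, map_one, dilate_of_isHomogeneous hp]
  exact irreducible_C_mul_X_pow_sub_one hm hπ hdvd hsq

end Dilate

section AdaptedBasis

variable {k V ι Γ : Type*} [Field k] [AddCommGroup V] [Module k V] [LinearOrder Γ]

/-- A basis of `V` extracted from the family `v` in which every `v i` expands through basis vectors
of weight at least that of `i`: the outcome of the greedy algorithm for maximal weight. -/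
structure AdaptedBasis (k : Type*) {V ι Γ : Type*} [Field k] [AddCommGroup V] [Module k V]
    [LE Γ] (v : ι → V) (w : ι → Γ) where
  index : Finset ι
  basis : Module.Basis index k V
  basis_apply : ∀ b, basis b = v b
  le_of_repr_ne_zero : ∀ i b, basis.repr (v i) b ≠ 0 → w i ≤ w b

theorem exists_linearIndepOn_forall_mem_span (v : ι → V) (w : ι → Γ) (s : Finset ι) :
    ∃ B ⊆ s, LinearIndepOn k v (B : Set ι) ∧
      ∀ i ∈ s, v i ∈ Submodule.span k (v '' {b | b ∈ B ∧ w i ≤ w b}) := by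
  classical
  induction s using Finset.induction_on_min_value w with
  | empty => exact ⟨∅, subset_rfl, by simp, by simp⟩
  | insert a s _ hmin ih =>
    obtain ⟨B, hBs, hB, hspan⟩ := ih
    by_cases ha : v a ∈ Submodule.span k (v '' B)
    · refine ⟨B, hBs.trans (s.subset_insert a), hB, (s.forall_mem_insert a _).2 ⟨?_, hspan⟩⟩
      convert ha using 3
      exact Set.ext fun b => and_iff_left_of_imp fun hb => hmin b (hBs hb)
    · refine ⟨insert a B, Finset.insert_subset_insert a hBs, ?_, (s.forall_mem_insert a _).2
        ⟨Submodule.subset_span ⟨a, ⟨B.mem_insert_self a, le_rfl⟩, rfl⟩, fun i hi => ?_⟩⟩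
      · rw [Finset.coe_insert]
        exact hB.insert ha
      · refine Submodule.span_mono (Set.image_mono ?_) (hspan i hi)
        exact fun b hb => ⟨Finset.mem_insert_of_mem hb.1, hb.2⟩

theorem nonempty_adaptedBasis [Finite ι] {v : ι → V} (hv : ⊤ ≤ Submodule.span k (Set.range v))
    (w : ι → Γ) : Nonempty (AdaptedBasis k v w) := by
  have := Fintype.ofFinite ι
  obtain ⟨B, -, hB, hmem⟩ := exists_linearIndepOn_forall_mem_span (k := k) v w Finset.univ
  have hspan : ⊤ ≤ Submodule.span k (Set.range fun b : B => v b) := by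
    refine hv.trans (Submodule.span_le.2 ?_)
    rintro _ ⟨i, rfl⟩
    refine Submodule.span_mono ?_ (hmem i (Finset.mem_univ i))
    rintro _ ⟨b, hb, rfl⟩
    exact ⟨⟨b, hb.1⟩, rfl⟩
  refine ⟨B, .mk hB hspan, fun b => Module.Basis.mk_apply hB hspan b, fun i b hb => ?_⟩
  have hi : v i ∈ Submodule.span k (Module.Basis.mk hB hspan '' {b : B | w i ≤ w b}) := by
    convert hmem i (Finset.mem_univ i) using 2
    ext x
    simp [and_assoc, and_left_comm]
  exact (Module.Basis.mem_span_image _).1 hi (Finsupp.mem_support_iff.2 hb)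

end AdaptedBasis

namespace AdaptedBasis

open MvPolynomial

variable {k V ι Γ : Type*} [Field k] [AddCommGroup V] [Module k V] [LinearOrder Γ]
  {v : ι → V} {w : ι → Γ} (B : AdaptedBasis k v w)

/-- The linear form in the basis variables obtained from the coordinates of a vector by keeping the
basis vectors of weight `g` only. -/
def weightForm (g : Γ) : V →ₗ[k] MvPolynomial B.index k :=
  B.basis.constr k fun b => if w b = g then X b else 0

/-- The part of smallest possible weight in the expansion of `v i`. -/
def leadForm (i : ι) : MvPolynomial B.index k :=
  B.weightForm (w i) (v i)

theorem weightForm_apply (g : Γ) (x : V) :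
    B.weightForm g x = ∑ b, B.basis.repr x b • if w b = g then X b else 0 :=
  B.basis.constr_apply_fintype k _ x

theorem weightForm_basis (g : Γ) (b : B.index) :
    B.weightForm g (v b) = if w b = g then X b else 0 := by
  rw [← B.basis_apply, weightForm, Module.Basis.constr_basis]

theorem leadForm_basis (b : B.index) : B.leadForm b = X b := by
  rw [leadForm, weightForm_basis, if_pos rfl]

theorem weightForm_eq_zero_of_lt {g : Γ} {i : ι} (hg : g < w i) : B.weightForm g (v i) = 0 := by
  rw [weightForm_apply]
  refine Finset.sum_eq_zero fun b _ => ?_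
  by_cases hb : B.basis.repr (v i) b = 0
  · rw [hb, zero_smul]
  · rw [if_neg (hg.trans_le (B.le_of_repr_ne_zero i b hb)).ne', smul_zero]

theorem isHomogeneous_weightForm (g : Γ) (x : V) : (B.weightForm g x).IsHomogeneous 1 := by
  rw [weightForm_apply]
  refine (homogeneousSubmodule B.index k 1).sum_mem fun b _ => Submodule.smul_mem _ _ ?_
  split_ifs
  · exact isHomogeneous_X k b
  · exact Submodule.zero_mem _

theorem coeff_weightForm (g : Γ) (x : V) (b : B.index) :
    (B.weightForm g x).coeff (Finsupp.single b 1) =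
      if w b = g then B.basis.repr x b else 0 := by
  classical
  rw [weightForm_apply, coeff_sum, Finset.sum_eq_single b]
  · split_ifs <;> simp
  · intro b' _ hb'
    split_ifs <;> simp [coeff_X, Finsupp.single_left_inj, hb']
  · simp

/-- Evaluation of the basis vectors at `f X_b * t ^ w b`, which deforms `v i` to its leading form
as `t` tends to `0`. -/
def deform {R : Type*} [CommRing R] [Algebra k R]
    (f : MvPolynomial B.index k →ₐ[k] R) : V →ₗ[k] HahnSeries Γ R :=
  B.basis.constr k fun b => HahnSeries.single (w b) (f (X b))

theorem coeff_deform {R : Type*} [CommRing R] [Algebra k R]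
    (f : MvPolynomial B.index k →ₐ[k] R) (x : V) (g : Γ) :
    (B.deform f x).coeff g = f (B.weightForm g x) := by
  rw [deform, Module.Basis.constr_apply_fintype, weightForm_apply, HahnSeries.coeff_sum, map_sum]
  refine Finset.sum_congr rfl fun b _ => ?_
  rw [HahnSeries.coeff_smul, HahnSeries.coeff_single, map_smul, apply_ite f, map_zero]
  simp only [eq_comm (a := g)]
  rfl

theorem exists_eq_smul_of_X_dvd_leadForm {b : B.index} (hb : ∀ i, w i ≤ w b) {i : ι}
    (hi : B.leadForm i ≠ 0) (hdvd : X b ∣ B.leadForm i) : ∃ r : k, v i = r • v b := by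
  classical
  have repr_eq_zero : ∀ b' ≠ b, w b' = w i → B.basis.repr (v i) b' = 0 := by
    intro b' hb' hw
    obtain ⟨q, hq⟩ := hdvd
    have hcoeff := B.coeff_weightForm (w i) (v i) b'
    rw [if_pos hw, ← leadForm, hq, coeff_X_mul', if_neg] at hcoeff
    · exact hcoeff.symm
    · simpa [Finsupp.single_apply] using hb'.symm
  have hwb : w b = w i := by
    by_contra hne
    refine hi ((B.weightForm_apply _ _).trans (Finset.sum_eq_zero fun b' _ => ?_))
    split_ifs with hw
    · rw [repr_eq_zero b' (by rintro rfl; exact hne hw) hw, zero_smul]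
    · rw [smul_zero]
  refine ⟨B.basis.repr (v i) b, B.basis.ext_elem fun b' => ?_⟩
  rw [← B.basis_apply, map_smul, Module.Basis.repr_self, Finsupp.smul_single, smul_eq_mul, mul_one]
  rcases eq_or_ne b' b with rfl | hb'
  · rw [Finsupp.single_eq_same]
  · rw [Finsupp.single_eq_of_ne hb']
    by_contra hne
    exact hne (repr_eq_zero b' hb'
      (((hb b').trans hwb.le).antisymm (B.le_of_repr_ne_zero i b' hne)))

theorem exists_forall_le_of_leadForm_ne_zero [Finite ι] [Nonempty ι]
    (hlead : ∀ i, B.leadForm i ≠ 0) : ∃ b : B.index, ∀ i, w i ≤ w b := by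
  obtain ⟨i, hi⟩ := Finite.exists_max w
  obtain ⟨b, -, hb⟩ := Finset.exists_ne_zero_of_sum_ne_zero
    ((B.weightForm_apply (w i) (v i)).symm.trans_ne (hlead i))
  exact ⟨b, fun j => (hi j).trans (B.le_of_repr_ne_zero i b (left_ne_zero_of_smul hb))⟩

theorem irreducible_prod_leadForm_sub_one [Fintype ι] [Nonempty ι]
    (hlead : ∀ i, B.leadForm i ≠ 0) (hv : ∀ i j (r : k), v i ≠ 0 → v i = r • v j → i = j) :
    Irreducible (∏ i, B.leadForm i - 1) := by
  classical
  obtain ⟨b, hb⟩ := B.exists_forall_le_of_leadForm_ne_zero hlead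
  have hX : Prime (X b : MvPolynomial B.index k) := X_prime
  have hprod : ∏ i, B.leadForm i = X b * ∏ i ∈ Finset.univ.erase (b : ι), B.leadForm i := by
    rw [← B.leadForm_basis, Finset.mul_prod_erase _ _ (Finset.mem_univ _)]
  refine irreducible_sub_one_of_isHomogeneous (m := ∑ _i : ι, 1) (by simp)
    (IsHomogeneous.prod _ _ _ fun i _ => B.isHomogeneous_weightForm _ _) hX
    (hprod ▸ dvd_mul_right _ _) fun hsq => ?_
  rw [hprod, sq] at hsq
  obtain ⟨i, hi, hdvd⟩ := hX.exists_mem_finset_dvd ((mul_dvd_mul_iff_left hX.ne_zero).1 hsq)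
  obtain ⟨r, hr⟩ := B.exists_eq_smul_of_X_dvd_leadForm hb (hlead i) hdvd
  have hvi : v i ≠ 0 := fun h => hlead i (by rw [leadForm, h, map_zero])
  exact Finset.ne_of_mem_erase hi (hv i b r hvi hr)

end AdaptedBasis

section Laurent

variable {k : Type u} [Field k] {n : ℕ} {S T : Type*} [CommRing S] [CommRing T]
  [Algebra k S] [Algebra k T]

/-- The Laurent monomials, as units. -/
def laurentMonomial (k : Type u) [Field k] (n : ℕ) :
    Multiplicative (Fin n → ℤ) →* (Laurent k n)ˣ :=
  (AddMonoidAlgebra.of k (Fin n → ℤ)).toHomUnits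

/-- The coordinate function `x_i` of the torus, as a unit. -/
def laurentX (k : Type u) [Field k] {n : ℕ} (i : Fin n) : (Laurent k n)ˣ :=
  laurentMonomial k n (.ofAdd (Pi.single i 1))

theorem prod_laurentX_zpow (u : Fin n → ℤ) :
    ∏ i, laurentX k i ^ u i = laurentMonomial k n (.ofAdd u) := by
  conv_rhs => rw [← Finset.univ_sum_single u, ofAdd_sum, map_prod]
  refine Finset.prod_congr rfl fun i _ => ?_
  rw [laurentX, ← map_zpow, ← ofAdd_zsmul, ← Pi.single_smul, smul_eq_mul, mul_one]

theorem toLaurent_X (i : Fin n) : toLaurent k n (MvPolynomial.X i) = laurentX k i :=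
  MvPolynomial.aeval_X _ i

/-- The evaluation of Laurent polynomials at a tuple of units. -/
def laurentEval (k : Type u) [Field k] {n : ℕ} {S : Type*} [CommRing S] [Algebra k S]
    (U : Fin n → Sˣ) : Laurent k n →ₐ[k] S :=
  AddMonoidAlgebra.lift k S (Fin n → ℤ) ((Units.coeHom S).comp
    { toFun := fun u => ∏ i, U i ^ u.toAdd i
      map_one' := by simp
      map_mul' := fun u v => by simp [zpow_add, Finset.prod_mul_distrib] })

theorem laurentEval_single (U : Fin n → Sˣ) (u : Fin n → ℤ) (r : k) :
    laurentEval k U (AddMonoidAlgebra.single u r) = r • ((∏ i, U i ^ u i : Sˣ) : S) :=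
  AddMonoidAlgebra.lift_single ..

theorem laurentEval_laurentX (U : Fin n → Sˣ) (i : Fin n) :
    laurentEval k U (laurentX k i) = U i := by
  refine (laurentEval_single U (Pi.single i 1) 1).trans ?_
  rw [one_smul, Finset.prod_eq_single i] <;> simp +contextual

theorem algHom_comp_laurentEval (φ : S →ₐ[k] T) (U : Fin n → Sˣ) :
    φ.comp (laurentEval k U) = laurentEval k fun i => Units.map (φ : S →* T) (U i) := by
  refine AddMonoidAlgebra.algHom_ext (fun u => ?_) (by ext)
  rw [AlgHom.comp_apply, laurentEval_single, laurentEval_single, one_smul, one_smul]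
  simp only [← map_zpow, ← map_prod]
  rfl

theorem laurentEval_laurentX_eq_id : laurentEval k (laurentX k (n := n)) = AlgHom.id k _ := by
  refine AddMonoidAlgebra.algHom_ext (fun u => ?_) (by ext)
  rw [laurentEval_single, one_smul, prod_laurentX_zpow]
  rfl

theorem laurentEval_map_laurentX (φ : Laurent k n →ₐ[k] S) :
    laurentEval k (fun i => Units.map (φ : Laurent k n →* S) (laurentX k i)) = φ := by
  rw [← algHom_comp_laurentEval, laurentEval_laurentX_eq_id, AlgHom.comp_id]

end Laurent

section Weight

variable {k : Type u} [Field k] {n : ℕ} {w : Fin n → ℝ} {W : ℝ} {f : Laurent k n}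

theorem weight_zero (w : Fin n → ℝ) : weight w 0 = 0 := by
  simp [weight]

theorem weight_one (w : Fin n → ℝ) : weight w 1 = ∑ i, w i := by
  simp [weight]

theorem weight_single (w : Fin n → ℝ) (i : Fin n) : weight w (Pi.single i 1) = w i := by
  rw [weight, Finset.sum_eq_single i] <;> simp +contextual

/-- The Laurent polynomials all of whose terms have `w`-weight at least `W`. -/
def weightGE (k : Type u) [Field k] {n : ℕ} (w : Fin n → ℝ) (W : ℝ) : Submodule k (Laurent k n) :=
  AddMonoidAlgebra.supported k k {u | W ≤ weight w u}

/-- The sum of the terms of `w`-weight `W` of a Laurent polynomial. -/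
def weightPart (k : Type u) [Field k] {n : ℕ} (w : Fin n → ℝ) (W : ℝ) :
    Laurent k n →ₗ[k] Laurent k n :=
  (AddMonoidAlgebra.basis (Fin n → ℤ) k).constr k fun u =>
    if weight w u = W then AddMonoidAlgebra.single u 1 else 0

theorem weightPart_single_one (w : Fin n → ℝ) (W : ℝ) (u : Fin n → ℤ) :
    weightPart k w W (AddMonoidAlgebra.single u 1) =
      if weight w u = W then AddMonoidAlgebra.single u 1 else 0 := by
  simp only [weightPart, ← AddMonoidAlgebra.basis_apply, Module.Basis.constr_basis]

theorem coeff_weightPart (w : Fin n → ℝ) (W : ℝ) (f : Laurent k n) (u : Fin n → ℤ) :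
    (weightPart k w W f).coeff u = if weight w u = W then f.coeff u else 0 := by
  classical
  induction f using AddMonoidAlgebra.induction_linear with
  | zero => simp
  | add f g hf hg =>
    rw [map_add, AddMonoidAlgebra.coeff_add, AddMonoidAlgebra.coeff_add, Finsupp.add_apply,
      Finsupp.add_apply, hf, hg]
    split_ifs <;> simp
  | single u' r =>
    rw [← mul_one r, ← smul_eq_mul, ← AddMonoidAlgebra.smul_single, map_smul,
      weightPart_single_one]
    by_cases huu' : u' = u
    · subst huu'
      split_ifs <;> simp
    · split_ifs <;> simp [huu']

theorem single_one_mem_weightGE {u : Fin n → ℤ} :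
    AddMonoidAlgebra.single u 1 ∈ weightGE k w W ↔ W ≤ weight w u := by
  rw [weightGE, AddMonoidAlgebra.supported_eq_span_single]
  exact AddMonoidAlgebra.single_mem_span_single

theorem weightPart_of_lt (hf : f ∈ weightGE k w W) {g : ℝ} (hg : g < W) :
    weightPart k w g f = 0 := by
  ext u
  rw [coeff_weightPart]
  split_ifs with hu
  · exact AddMonoidAlgebra.mem_supported'.1 hf u fun h => (hg.trans_le h).ne' hu
  · rfl

theorem initialForm_eq_weightPart (hf : f ∈ weightGE k w W) (hW : weightPart k w W f ≠ 0) :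
    initialForm w f = weightPart k w W f := by
  classical
  obtain ⟨v, hv⟩ : ∃ v, (weightPart k w W f).coeff v ≠ 0 := by
    by_contra! h
    exact hW (AddMonoidAlgebra.ext (Finsupp.ext h))
  rw [coeff_weightPart, ite_ne_right_iff] at hv
  ext u
  rw [initialForm, AddMonoidAlgebra.coeff_ofCoeff, coeff_weightPart, Finsupp.filter_apply]
  by_cases hu : u ∈ f.coeff.support
  · exact if_congr ⟨fun h => (hv.1 ▸ h v (Finsupp.mem_support_iff.2 hv.2)).antisymm (hf hu),
      fun h v hv => h.trans_le (hf hv)⟩ rfl rfl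
  · rw [Finsupp.notMem_support_iff.1 hu, ite_self, ite_self]

theorem exists_initialForm_eq_weightPart (w : Fin n → ℝ) (f : Laurent k n) :
    ∃ W, f ∈ weightGE k w W ∧ initialForm w f = weightPart k w W f := by
  rcases f.coeff.support.eq_empty_or_nonempty with h | h
  · obtain rfl : f = 0 := AddMonoidAlgebra.ext (by simpa [Finsupp.ext_iff] using h)
    refine ⟨0, zero_mem _, ?_⟩
    rw [map_zero, initialForm, AddMonoidAlgebra.coeff_zero, Finsupp.filter_zero]
    rfl
  · obtain ⟨v, hv, hmin⟩ := Finset.exists_min_image _ (weight w) h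
    refine ⟨weight w v, hmin, initialForm_eq_weightPart hmin fun h0 => ?_⟩
    have hcoeff := congr(($h0).coeff v)
    rw [coeff_weightPart, if_pos rfl] at hcoeff
    exact Finsupp.mem_support_iff.1 hv hcoeff

theorem weightPart_mem_initialIdeal {I : Ideal (Laurent k n)} (hf : f ∈ I)
    (hW : f ∈ weightGE k w W) : weightPart k w W f ∈ initialIdeal w I := by
  by_cases h : weightPart k w W f = 0
  · rw [h]
    exact zero_mem _
  · rw [← initialForm_eq_weightPart hW h]
    exact Ideal.subset_span ⟨f, hf, rfl⟩

end Weight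

section Hahn

open HahnSeries

section Homs

variable {Γ S : Type*} [AddCommGroup Γ] [LinearOrder Γ] [CommRing S]

theorem order_eq_and_leadingCoeff_eq {x : HahnSeries Γ S} {g : Γ} (hg : x.coeff g ≠ 0)
    (hlt : ∀ g' < g, x.coeff g' = 0) : x.order = g ∧ x.leadingCoeff = x.coeff g := by
  have hx : x ≠ 0 := by
    rintro rfl
    exact hg rfl
  have horder : x.order = g :=
    (order_le_of_coeff_ne_zero hg).antisymm ((le_order_iff_forall hx).2 hlt)
  exact ⟨horder, by rw [leadingCoeff_eq, horder]⟩

variable (Γ S) [IsOrderedAddMonoid Γ] [IsDomain S]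

/-- The order of a Hahn series as a homomorphism on units. -/
def unitsOrder : (HahnSeries Γ S)ˣ →* Multiplicative Γ where
  toFun x := .ofAdd (x : HahnSeries Γ S).order
  map_one' := by simp
  map_mul' x y := by rw [Units.val_mul, order_mul x.ne_zero y.ne_zero, ofAdd_add]

/-- The leading coefficient of a Hahn series as a homomorphism. -/
def leadingCoeffHom : HahnSeries Γ S →* S where
  toFun x := x.leadingCoeff
  map_one' := leadingCoeff_one
  map_mul' x y := leadingCoeff_mul x y

variable {Γ S}

theorem leadingCoeff_dvd_coeff_mul {x y : HahnSeries Γ S} {g : Γ} (hx : x ≠ 0)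
    (hlt : ∀ g' < g, (x * y).coeff g' = 0) : x.leadingCoeff ∣ (x * y).coeff g := by
  rcases eq_or_ne y 0 with rfl | hy
  · simp
  rcases ((le_order_iff_forall (mul_ne_zero hx hy)).2 hlt).eq_or_lt with h | h
  · rw [h, ← leadingCoeff_eq, leadingCoeff_mul]
    exact dvd_mul_right _ _
  · rw [coeff_eq_zero_of_lt_order h]
    exact dvd_zero _

end Homs

-- Otherwise `HahnSeries.powerSeriesAlgebra` is found, whose action is not coefficientwise at
-- reducible transparency.
attribute [local instance high] HahnSeries.instAlgebra

variable {k : Type u} [Field k] {n : ℕ} {S : Type*} [CommRing S] [IsDomain S]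
  {U : Fin n → (HahnSeries ℝ S)ˣ} {V : Fin n → Sˣ} {w : Fin n → ℝ}

theorem order_prod_zpow (hU : ∀ i, (U i : HahnSeries ℝ S).order = w i) (u : Fin n → ℤ) :
    ((∏ i, U i ^ u i : (HahnSeries ℝ S)ˣ) : HahnSeries ℝ S).order = weight w u := by
  have h : unitsOrder ℝ S (∏ i, U i ^ u i) = ∏ i, unitsOrder ℝ S (U i) ^ u i := by
    simp only [map_prod, map_zpow]
  refine congr(Multiplicative.toAdd $h).trans ((toAdd_prod _ _).trans ?_)
  refine Finset.sum_congr rfl fun i _ => ?_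
  rw [toAdd_zpow, zsmul_eq_mul, mul_comm]
  exact congr($(hU i) * _)

theorem leadingCoeff_prod_zpow (hV : ∀ i, (U i : HahnSeries ℝ S).leadingCoeff = V i)
    (u : Fin n → ℤ) :
    ((∏ i, U i ^ u i : (HahnSeries ℝ S)ˣ) : HahnSeries ℝ S).leadingCoeff =
      ((∏ i, V i ^ u i : Sˣ) : S) := by
  have hV' : ∀ i, Units.map (leadingCoeffHom ℝ S) (U i) = V i := fun i => Units.ext (hV i)
  have h : Units.map (leadingCoeffHom ℝ S) (∏ i, U i ^ u i) = ∏ i, V i ^ u i := by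
    simp only [map_prod, map_zpow, hV']
  exact congr(($h : S))

theorem leadingCoeff_prod_sub_one (hU : ∀ i, (U i : HahnSeries ℝ S).order = w i)
    (hV : ∀ i, (U i : HahnSeries ℝ S).leadingCoeff = V i) (hw : ∑ i, w i = 0)
    (h : ∏ i, (V i : S) ≠ 1) :
    (∏ i, (U i : HahnSeries ℝ S) - 1).leadingCoeff = ∏ i, (V i : S) - 1 := by
  have horder := order_prod_zpow hU 1
  have hlead := leadingCoeff_prod_zpow hV 1
  simp only [Pi.one_apply, zpow_one, Units.coe_prod, weight_one, hw] at horder hlead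
  have hcoeff : (∏ i, (U i : HahnSeries ℝ S) - 1).coeff 0 = ∏ i, (V i : S) - 1 := by
    rw [coeff_sub, coeff_one, if_pos rfl, ← hlead, leadingCoeff_eq, horder]
  rw [← hcoeff]
  refine (order_eq_and_leadingCoeff_eq (hcoeff.trans_ne (sub_ne_zero.2 h)) fun g hg => ?_).2
  rw [coeff_sub, coeff_eq_zero_of_lt_order (hg.trans_eq horder.symm), coeff_one, if_neg hg.ne,
    sub_zero]

variable [Algebra k S]

theorem coeff_laurentEval (hU : ∀ i, (U i : HahnSeries ℝ S).order = w i)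
    (hV : ∀ i, (U i : HahnSeries ℝ S).leadingCoeff = V i) {f : Laurent k n} {W : ℝ}
    (hf : f ∈ weightGE k w W) :
    (laurentEval k U f).coeff W = laurentEval k V (weightPart k w W f) := by
  rw [weightGE, AddMonoidAlgebra.supported_eq_span_single] at hf
  induction hf using Submodule.span_induction with
  | zero => simp
  | add f g _ _ hf hg => rw [map_add, coeff_add, hf, hg, map_add, map_add]
  | smul r f _ hf => rw [map_smul, HahnSeries.coeff_smul, hf, map_smul, map_smul]
  | mem f hf =>
    obtain ⟨u, hu, rfl⟩ := hf
    rw [weightPart_single_one, laurentEval_single, one_smul]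
    split_ifs with hW
    · rw [laurentEval_single, one_smul, ← leadingCoeff_prod_zpow hV, leadingCoeff_eq,
        order_prod_zpow hU, hW]
    · rw [map_zero, coeff_eq_zero_of_lt_order]
      rw [order_prod_zpow hU]
      exact lt_of_le_of_ne hu (Ne.symm hW)

theorem leadingCoeff_dvd_laurentEval_initialForm
    (hU : ∀ i, (U i : HahnSeries ℝ S).order = w i)
    (hV : ∀ i, (U i : HahnSeries ℝ S).leadingCoeff = V i) {x : HahnSeries ℝ S} (hx : x ≠ 0)
    {f : Laurent k n} (hf : x ∣ laurentEval k U f) :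
    x.leadingCoeff ∣ laurentEval k V (initialForm w f) := by
  obtain ⟨W, hW, hin⟩ := exists_initialForm_eq_weightPart w f
  obtain ⟨y, hy⟩ := hf
  rw [hin, ← coeff_laurentEval hU hV hW, hy]
  refine leadingCoeff_dvd_coeff_mul hx fun g hg => ?_
  have hWg : f ∈ weightGE k w g :=
    AddMonoidAlgebra.supported_mono (fun u hu => hg.le.trans hu) hW
  rw [← hy, coeff_laurentEval hU hV hWg, weightPart_of_lt hW hg, map_zero]

theorem initialIdeal_le_comap_laurentEval
    (hU : ∀ i, (U i : HahnSeries ℝ S).order = w i)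
    (hV : ∀ i, (U i : HahnSeries ℝ S).leadingCoeff = V i) {x : HahnSeries ℝ S} (hx : x ≠ 0)
    {I : Ideal (Laurent k n)} (hI : I ≤ (Ideal.span {x}).comap (laurentEval k U)) :
    initialIdeal w I ≤ (Ideal.span {x.leadingCoeff}).comap (laurentEval k V) := by
  rw [initialIdeal, Ideal.span_le]
  rintro _ ⟨f, hf, rfl⟩
  exact Ideal.mem_span_singleton.2 (leadingCoeff_dvd_laurentEval_initialForm hU hV hx
    (Ideal.mem_span_singleton.1 (hI hf)))

end Hahn

section MilnorFiber

variable {k : Type u} [Field k] {n : ℕ} {A : Submodule k (Fin n → k)} {w : Fin n → ℝ}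

theorem span_range_coord (A : Submodule k (Fin n → k)) :
    Submodule.span k (Set.range (coord A)) = ⊤ := by
  refine eq_top_iff.2 fun φ _ => ?_
  obtain ⟨ψ, rfl⟩ := LinearMap.exists_extend φ
  have hψ : ψ ∘ₗ A.subtype = ∑ i, ψ (Pi.single i 1) • coord A i := by
    ext x
    conv_lhs => rw [LinearMap.comp_apply, pi_eq_sum_univ' (A.subtype x)]
    simp [coord, mul_comm]
  rw [hψ]
  exact Submodule.sum_mem _ fun i _ => Submodule.smul_mem _ _ (Submodule.subset_span ⟨i, rfl⟩)

theorem linearCombination_coord_eq_zero_iff {a : Fin n → k} :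
    Fintype.linearCombination k (coord A) a = 0 ↔ ∀ v ∈ A, ∑ i, a i * v i = 0 := by
  rw [Fintype.linearCombination_apply, LinearMap.ext_iff]
  simp [coord]

theorem toLaurent_linearForm (a : Fin n → k) :
    toLaurent k n (∑ i, MvPolynomial.C (a i) * MvPolynomial.X i) =
      Fintype.linearCombination k (fun i : Fin n => (laurentX k i : Laurent k n)) a := by
  simp only [Fintype.linearCombination_apply, map_sum, ← MvPolynomial.smul_eq_C_mul, map_smul,
    toLaurent_X]

theorem toLaurent_prod_X :
    toLaurent k n (∏ i, MvPolynomial.X i) = ∏ i : Fin n, (laurentX k i : Laurent k n) := by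
  simp only [map_prod, toLaurent_X]

theorem linearCombination_laurentX_mem_milnorTorusIdeal {a : Fin n → k}
    (ha : Fintype.linearCombination k (coord A) a = 0) :
    Fintype.linearCombination k (fun i : Fin n => (laurentX k i : Laurent k n)) a ∈
      milnorTorusIdeal A := by
  rw [← toLaurent_linearForm]
  exact Ideal.mem_map_of_mem _ (Ideal.mem_sup_left
    (Ideal.subset_span ⟨a, linearCombination_coord_eq_zero_iff.1 ha, rfl⟩))

theorem prod_laurentX_sub_one_mem_milnorTorusIdeal :
    ∏ i : Fin n, (laurentX k i : Laurent k n) - 1 ∈ milnorTorusIdeal A := by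
  rw [← toLaurent_prod_X, ← map_one (toLaurent k n), ← map_sub]
  exact Ideal.mem_map_of_mem _ (Ideal.mem_sup_right (Ideal.subset_span rfl))

theorem milnorTorusIdeal_le_comap_laurentEval {S : Type*} [CommRing S] [Algebra k S]
    {U : Fin n → Sˣ} (D : (A →ₗ[k] k) →ₗ[k] S) (hD : ∀ i, D (coord A i) = U i) :
    milnorTorusIdeal A ≤ (Ideal.span {∏ i, (U i : S) - 1}).comap (laurentEval k U) := by
  rw [milnorTorusIdeal, Ideal.map_le_iff_le_comap, milnorIdeal, sup_le_iff, linearIdeal,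
    Ideal.span_le, Ideal.span_le, Set.singleton_subset_iff]
  refine ⟨?_, ?_⟩
  · rintro _ ⟨a, ha, rfl⟩
    have hDa : laurentEval k U
        (Fintype.linearCombination k (fun i : Fin n => (laurentX k i : Laurent k n)) a) =
          D (Fintype.linearCombination k (coord A) a) := by
      simp only [Fintype.linearCombination_apply, map_sum, map_smul, laurentEval_laurentX, hD]
    rw [SetLike.mem_coe, Ideal.mem_comap, Ideal.mem_comap, toLaurent_linearForm, hDa,
      linearCombination_coord_eq_zero_iff.2 ha, map_zero]
    exact zero_mem _
  · rw [SetLike.mem_coe, Ideal.mem_comap, Ideal.mem_comap, map_sub, toLaurent_prod_X, map_one,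
      map_sub, map_prod, map_one]
    simp only [laurentEval_laurentX]
    exact Ideal.mem_span_singleton_self _

theorem laurentX_mem_weightGE {i : Fin n} {W : ℝ} (hW : W ≤ w i) :
    (laurentX k i : Laurent k n) ∈ weightGE k w W :=
  single_one_mem_weightGE.2 (hW.trans_eq (weight_single w i).symm)

theorem weightPart_laurentX (W : ℝ) (i : Fin n) :
    weightPart k w W (laurentX k i) = if w i = W then (laurentX k i : Laurent k n) else 0 := by
  rw [← weight_single w i]
  exact weightPart_single_one w W _

end MilnorFiber

section ProductRelation

variable {k : Type u} [Field k] {n : ℕ} {A : Submodule k (Fin n → k)} {w : Fin n → ℝ}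

theorem prod_laurentX_eq_single :
    ∏ i : Fin n, (laurentX k i : Laurent k n) = AddMonoidAlgebra.single 1 1 := by
  have h := prod_laurentX_zpow (k := k) (1 : Fin n → ℤ)
  simp only [Pi.one_apply, zpow_one] at h
  rw [← Units.coe_prod, h]
  rfl

theorem prod_laurentX_sub_one_mem_weightGE {W : ℝ} (hW : W ≤ ∑ i, w i) (hW0 : W ≤ 0) :
    ∏ i : Fin n, (laurentX k i : Laurent k n) - 1 ∈ weightGE k w W := by
  rw [prod_laurentX_eq_single, AddMonoidAlgebra.one_def]
  exact sub_mem (single_one_mem_weightGE.2 (hW.trans_eq (weight_one w).symm))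
    (single_one_mem_weightGE.2 (hW0.trans_eq (weight_zero w).symm))

theorem weightPart_prod_laurentX_sub_one (W : ℝ) :
    weightPart k w W (∏ i : Fin n, (laurentX k i : Laurent k n) - 1) =
      (if ∑ i, w i = W then ∏ i : Fin n, (laurentX k i : Laurent k n) else 0) -
        if 0 = W then 1 else 0 := by
  rw [prod_laurentX_eq_single, AddMonoidAlgebra.one_def, map_sub, weightPart_single_one,
    weightPart_single_one, weight_one, weight_zero]

theorem initialIdeal_milnorTorusIdeal_eq_top_of_sum_ne_zero (hw : ∑ i, w i ≠ 0) :
    initialIdeal w (milnorTorusIdeal A) = ⊤ := by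
  rcases hw.lt_or_gt with h | h
  · have hmem := weightPart_mem_initialIdeal (prod_laurentX_sub_one_mem_milnorTorusIdeal (A := A))
      (prod_laurentX_sub_one_mem_weightGE le_rfl h.le)
    rw [weightPart_prod_laurentX_sub_one, if_pos rfl, if_neg hw.symm, sub_zero,
      ← Units.coe_prod] at hmem
    exact Ideal.eq_top_of_isUnit_mem _ hmem (Units.isUnit _)
  · have hmem := weightPart_mem_initialIdeal (prod_laurentX_sub_one_mem_milnorTorusIdeal (A := A))
      (prod_laurentX_sub_one_mem_weightGE h.le le_rfl)
    rw [weightPart_prod_laurentX_sub_one, if_neg hw, if_pos rfl, zero_sub] at hmem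
    exact Ideal.eq_top_of_isUnit_mem _ hmem isUnit_one.neg

theorem prod_laurentX_sub_one_mem_initialIdeal (hw : ∑ i, w i = 0) :
    ∏ i : Fin n, (laurentX k i : Laurent k n) - 1 ∈ initialIdeal w (milnorTorusIdeal A) := by
  have hmem := weightPart_mem_initialIdeal (prod_laurentX_sub_one_mem_milnorTorusIdeal (A := A))
    (prod_laurentX_sub_one_mem_weightGE hw.ge le_rfl)
  rwa [weightPart_prod_laurentX_sub_one, if_pos hw, if_pos rfl] at hmem

end ProductRelation

section InitialIdeal

open MvPolynomial

variable {k : Type u} [Field k] {n : ℕ} {A : Submodule k (Fin n → k)} {w : Fin n → ℝ}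
  (B : AdaptedBasis k (coord A) w)

theorem laurentX_sub_constr_mem_milnorTorusIdeal (i : Fin n) :
    (laurentX k i : Laurent k n) -
      B.basis.constr k (fun b => (laurentX k (b : Fin n) : Laurent k n)) (coord A i) ∈
        milnorTorusIdeal A := by
  let a : Fin n → k := Pi.single i 1 - ∑ b, B.basis.repr (coord A i) b • Pi.single (b : Fin n) 1
  have ha : Fintype.linearCombination k (coord A) a = 0 := by
    simp only [a, map_sub, map_sum, map_smul, Fintype.linearCombination_apply_single, one_smul,
      ← B.basis_apply, B.basis.sum_repr, sub_self]
  convert linearCombination_laurentX_mem_milnorTorusIdeal ha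
  simp only [a, map_sub, map_sum, map_smul, Fintype.linearCombination_apply_single, one_smul,
    Module.Basis.constr_apply_fintype, Module.Basis.equivFun_apply]

theorem constr_laurentX_mem_weightGE (i : Fin n) :
    B.basis.constr k (fun b => (laurentX k (b : Fin n) : Laurent k n)) (coord A i) ∈
      weightGE k w (w i) := by
  rw [Module.Basis.constr_apply_fintype]
  refine Submodule.sum_mem _ fun b _ => ?_
  by_cases hb : B.basis.repr (coord A i) b = 0
  · rw [Module.Basis.equivFun_apply, hb, zero_smul]
    exact zero_mem _
  · exact Submodule.smul_mem _ _ (laurentX_mem_weightGE (B.le_of_repr_ne_zero i b hb))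

theorem weightPart_constr_laurentX (W : ℝ) (x : A →ₗ[k] k) :
    weightPart k w W (B.basis.constr k (fun b => (laurentX k (b : Fin n) : Laurent k n)) x) =
      aeval (fun b : B.index => (laurentX k (b : Fin n) : Laurent k n)) (B.weightForm W x) := by
  suffices h : weightPart k w W ∘ₗ
      B.basis.constr k (fun b => (laurentX k (b : Fin n) : Laurent k n)) =
        (aeval fun b : B.index => (laurentX k (b : Fin n) : Laurent k n)).toLinearMap ∘ₗ
          B.weightForm W from congr($h x)
  refine B.basis.ext fun b => ?_
  rw [LinearMap.comp_apply, LinearMap.comp_apply, Module.Basis.constr_basis, weightPart_laurentX,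
    B.basis_apply, B.weightForm_basis]
  split_ifs
  · rw [AlgHom.toLinearMap_apply, aeval_X]
  · rw [map_zero]

theorem laurentX_sub_aeval_leadForm_mem_initialIdeal (i : Fin n) :
    (laurentX k i : Laurent k n) -
      aeval (fun b : B.index => (laurentX k (b : Fin n) : Laurent k n)) (B.leadForm i) ∈
        initialIdeal w (milnorTorusIdeal A) := by
  have hmem := weightPart_mem_initialIdeal (laurentX_sub_constr_mem_milnorTorusIdeal B i)
    (sub_mem (laurentX_mem_weightGE le_rfl) (constr_laurentX_mem_weightGE B i))
  rwa [map_sub, weightPart_laurentX, if_pos rfl, weightPart_constr_laurentX] at hmem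

theorem initialIdeal_milnorTorusIdeal_eq_top_of_leadForm_eq_zero {i : Fin n}
    (hi : B.leadForm i = 0) : initialIdeal w (milnorTorusIdeal A) = ⊤ := by
  have hmem := laurentX_sub_aeval_leadForm_mem_initialIdeal B i
  rw [hi, map_zero, sub_zero] at hmem
  exact Ideal.eq_top_of_isUnit_mem _ hmem (Units.isUnit _)

end InitialIdeal

section Localization

theorem exists_injective_algHom_isUnit_comp_eq {k : Type*} {P : Type u} {Q : Type*} [CommRing k]
    [CommRing P] [IsDomain P] [CommRing Q] [Algebra k P] [Algebra k Q] {h : P} (hh : h ≠ 0)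
    (π : P →ₐ[k] Q) (hπ : IsUnit (π h)) :
    ∃ (S : Type u) (_ : CommRing S) (_ : IsDomain S) (_ : Algebra k S) (f : P →ₐ[k] S)
      (φ : S →ₐ[k] Q), Function.Injective f ∧ IsUnit (f h) ∧ φ.comp f = π := by
  have hpow : Submonoid.powers h ≤ nonZeroDivisors P :=
    powers_le_nonZeroDivisors_of_noZeroDivisors hh
  have isUnit_pow : ∀ y : Submonoid.powers h, IsUnit (π y) := by
    rintro ⟨_, m, rfl⟩
    simpa only [map_pow] using hπ.pow m
  exact ⟨Localization.Away h, inferInstance, IsLocalization.isDomain_localization hpow,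
    inferInstance, IsScalarTower.toAlgHom k P _, IsLocalization.liftAlgHom isUnit_pow,
    IsLocalization.injective _ hpow, IsLocalization.Away.algebraMap_isUnit h,
    AlgHom.ext fun p => IsLocalization.lift_eq isUnit_pow p⟩

end Localization

section Deformation

variable {k : Type u} [Field k]

theorem AdaptedBasis.exists_unit_eq_deform {V ι Γ : Type*} [AddCommGroup V] [Module k V]
    [AddCommGroup Γ] [LinearOrder Γ] [IsOrderedAddMonoid Γ] {v : ι → V} {w : ι → Γ}
    (B : AdaptedBasis k v w) {S : Type*} [CommRing S] [IsDomain S] [Algebra k S]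
    (f : MvPolynomial B.index k →ₐ[k] S) {i : ι} {r : Sˣ} (hr : f (B.leadForm i) = r) :
    ∃ U : (HahnSeries Γ S)ˣ, B.deform f (v i) = U ∧ (U : HahnSeries Γ S).order = w i ∧
      (U : HahnSeries Γ S).leadingCoeff = r := by
  have hcoeff : (B.deform f (v i)).coeff (w i) = r := (B.coeff_deform f (v i) (w i)).trans hr
  obtain ⟨horder, hlead⟩ := order_eq_and_leadingCoeff_eq (hcoeff.trans_ne r.ne_zero)
    fun g hg => by rw [B.coeff_deform, B.weightForm_eq_zero_of_lt hg, map_zero]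
  rw [hcoeff] at hlead
  have hunit : IsUnit (B.deform f (v i)) := by
    rw [HahnSeries.isUnit_iff, hlead]
    exact r.isUnit
  exact ⟨hunit.unit, rfl, horder, hlead⟩

attribute [local instance high] HahnSeries.instAlgebra

theorem initialIdeal_milnorTorusIdeal_le_comap {n : ℕ} {A : Submodule k (Fin n → k)}
    {w : Fin n → ℝ} (B : AdaptedBasis k (coord A) w) {S : Type*} [CommRing S] [IsDomain S]
    [Algebra k S] (f : MvPolynomial B.index k →ₐ[k] S) {V : Fin n → Sˣ}
    (hV : ∀ i, f (B.leadForm i) = V i) (hw : ∑ i, w i = 0) (h : ∏ i, (V i : S) ≠ 1) :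
    initialIdeal w (milnorTorusIdeal A) ≤
      (Ideal.span {∏ i, (V i : S) - 1}).comap (laurentEval k V) := by
  choose U hdeform horder hlead using fun i => B.exists_unit_eq_deform f (hV i)
  have hx := leadingCoeff_prod_sub_one horder hlead hw h
  rw [← hx]
  refine initialIdeal_le_comap_laurentEval horder hlead (HahnSeries.leadingCoeff_ne_zero.1 ?_)
    (milnorTorusIdeal_le_comap_laurentEval (B.deform f) hdeform)
  rw [hx]
  exact sub_ne_zero.2 h

end Deformation

section LeadRing

open MvPolynomial

variable {k : Type u} [Field k] {n : ℕ} {A : Submodule k (Fin n → k)} {w : Fin n → ℝ}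
  (B : AdaptedBasis k (coord A) w)

/-- The coordinate ring of the hypersurface on which the product of the leading forms is `1`. -/
abbrev LeadRing : Type u :=
  MvPolynomial B.index k ⧸ Ideal.span {∏ i, B.leadForm i - 1}

theorem prod_mk_leadForm_eq_one :
    ∏ i, Ideal.Quotient.mkₐ k (Ideal.span {∏ i, B.leadForm i - 1}) (B.leadForm i) = 1 := by
  rw [← map_prod, ← map_one (Ideal.Quotient.mkₐ k _)]
  exact Ideal.Quotient.eq.2 (Ideal.mem_span_singleton_self _)

theorem isUnit_mk_leadForm (i : Fin n) :
    IsUnit (Ideal.Quotient.mkₐ k (Ideal.span {∏ i, B.leadForm i - 1}) (B.leadForm i)) :=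
  isUnit_of_dvd_one (prod_mk_leadForm_eq_one B ▸ Finset.dvd_prod_of_mem _ (Finset.mem_univ i))

/-- The leading forms as units of the coordinate ring `LeadRing B`; they are the coordinates of an
embedding of the hypersurface into the torus. -/
def leadUnit (i : Fin n) : (LeadRing B)ˣ :=
  (isUnit_mk_leadForm B i).unit

theorem initialIdeal_milnorTorusIdeal_le_ker_of_comp_eq {S : Type*} [CommRing S] [IsDomain S]
    [Algebra k S] {f : MvPolynomial B.index k →ₐ[k] S} (hf : Function.Injective f)
    (hunit : ∀ i, IsUnit (f (B.leadForm i))) {φ : S →ₐ[k] LeadRing B}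
    (hφ : φ.comp f = Ideal.Quotient.mkₐ k _) (hw : ∑ i, w i = 0)
    (hlead : ∏ i, B.leadForm i ≠ 1) :
    initialIdeal w (milnorTorusIdeal A) ≤ RingHom.ker (laurentEval k (leadUnit B)) := by
  choose V hV using hunit
  have hprod : ∏ i, (V i : S) = f (∏ i, B.leadForm i) := by
    simp only [hV, map_prod]
  have hprod_ne : ∏ i, (V i : S) ≠ 1 := by
    rw [hprod, ← map_one f]
    exact hf.ne hlead
  have hcomp : φ.comp (laurentEval k V) = laurentEval k (leadUnit B) := by
    rw [algHom_comp_laurentEval]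
    congr 1
    funext i
    exact Units.ext ((congrArg φ (hV i)).trans (DFunLike.congr_fun hφ _))
  have hle := initialIdeal_milnorTorusIdeal_le_comap B f (fun i => (hV i).symm) hw hprod_ne
  intro p hp
  obtain ⟨q, hq⟩ := Ideal.mem_span_singleton.1 (Ideal.mem_comap.1 (hle hp))
  rw [RingHom.mem_ker, ← hcomp, AlgHom.comp_apply, hq, hprod, map_mul, map_sub,
    ← AlgHom.comp_apply, hφ, map_prod, prod_mk_leadForm_eq_one, map_one, sub_self, zero_mul]

theorem initialIdeal_milnorTorusIdeal_le_ker (hw : ∑ i, w i = 0)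
    (hlead : ∀ i, B.leadForm i ≠ 0) (hprod : ∏ i, B.leadForm i ≠ 1) :
    initialIdeal w (milnorTorusIdeal A) ≤ RingHom.ker (laurentEval k (leadUnit B)) := by
  have hone : Ideal.Quotient.mkₐ k (Ideal.span {∏ i, B.leadForm i - 1}) (∏ i, B.leadForm i) = 1 :=
    (map_prod _ _ _).trans (prod_mk_leadForm_eq_one B)
  obtain ⟨S, _, _, _, f, φ, hf, hunit, hφ⟩ := exists_injective_algHom_isUnit_comp_eq
    (Finset.prod_ne_zero_iff.2 fun i _ => hlead i) _ (hone ▸ isUnit_one)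
  refine initialIdeal_milnorTorusIdeal_le_ker_of_comp_eq B hf (fun i => ?_) hφ hw hprod
  exact isUnit_of_dvd_unit (map_dvd f (Finset.dvd_prod_of_mem _ (Finset.mem_univ i))) hunit

theorem ker_laurentEval_leadUnit_le_initialIdeal (hw : ∑ i, w i = 0) :
    RingHom.ker (laurentEval k (leadUnit B)) ≤ initialIdeal w (milnorTorusIdeal A) := by
  let mk := Ideal.Quotient.mkₐ k (initialIdeal w (milnorTorusIdeal A))
  let φ := mk.comp (aeval fun b : B.index => (laurentX k (b : Fin n) : Laurent k n))
  have hφ : ∀ i, φ (B.leadForm i) = mk (laurentX k i) := fun i =>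
    (Ideal.Quotient.eq.2 (laurentX_sub_aeval_leadForm_mem_initialIdeal B i)).symm
  have hprod : φ (∏ i, B.leadForm i - 1) = 0 := by
    simp only [map_sub, map_prod, hφ, map_one]
    rw [← map_prod, ← map_one mk, ← map_sub]
    exact Ideal.Quotient.eq_zero_iff_mem.2 (prod_laurentX_sub_one_mem_initialIdeal hw)
  let ψ : LeadRing B →ₐ[k] _ := Ideal.Quotient.liftₐ _ φ fun p hp => by
    obtain ⟨q, rfl⟩ := Ideal.mem_span_singleton.1 hp
    rw [map_mul, hprod, zero_mul]
  have hcomp : ψ.comp (laurentEval k (leadUnit B)) = mk := by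
    rw [algHom_comp_laurentEval, ← laurentEval_map_laurentX mk]
    congr 1
    funext i
    exact Units.ext (hφ i)
  intro p hp
  refine Ideal.Quotient.eq_zero_iff_mem.1 ((DFunLike.congr_fun hcomp p).symm.trans ?_)
  rw [AlgHom.comp_apply, RingHom.mem_ker.1 hp, map_zero]

end LeadRing

section Irreducible

variable {k : Type u} [Field k] {n : ℕ}

theorem isPrime_initialIdeal_milnorTorusIdeal {A : Submodule k (Fin n → k)} {w : Fin n → ℝ}
    (B : AdaptedBasis k (coord A) w) (hw : ∑ i, w i = 0) (hlead : ∀ i, B.leadForm i ≠ 0)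
    (hirr : Irreducible (∏ i, B.leadForm i - 1)) :
    (initialIdeal w (milnorTorusIdeal A)).IsPrime := by
  have : (Ideal.span {∏ i, B.leadForm i - 1}).IsPrime :=
    (Ideal.span_singleton_prime hirr.ne_zero).2 hirr.prime
  rw [(initialIdeal_milnorTorusIdeal_le_ker B hw hlead (sub_ne_zero.1 hirr.ne_zero)).antisymm
    (ker_laurentEval_leadUnit_le_initialIdeal B hw)]
  exact RingHom.ker_isPrime _

theorem initialIdeal_milnorTorusIdeal_eq_top_or_isPrime (hn : 0 < n) {A : Submodule k (Fin n → k)}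
    (hA : ∀ i j (r : k), coord A i ≠ 0 → coord A i = r • coord A j → i = j) (w : Fin n → ℝ) :
    initialIdeal w (milnorTorusIdeal A) = ⊤ ∨ (initialIdeal w (milnorTorusIdeal A)).IsPrime := by
  have : Nonempty (Fin n) := Fin.pos_iff_nonempty.1 hn
  by_cases hw : ∑ i, w i = 0
  · obtain ⟨B⟩ := nonempty_adaptedBasis (span_range_coord A).ge w
    by_cases! hlead : ∀ i, B.leadForm i ≠ 0
    · exact .inr (isPrime_initialIdeal_milnorTorusIdeal B hw hlead
        (B.irreducible_prod_leadForm_sub_one hlead hA))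
    · obtain ⟨i, hi⟩ := hlead
      exact .inl (initialIdeal_milnorTorusIdeal_eq_top_of_leadForm_eq_zero B hi)
  · exact .inl (initialIdeal_milnorTorusIdeal_eq_top_of_sum_ne_zero hw)

theorem parallel_of_eq_smul {ι V : Type*} [AddCommGroup V] [Module k V] {v : ι → V}
    {M : Matroid ι} (hM : ∀ I : Set ι, M.Indep I ↔ LinearIndepOn k v I) {i j : ι} {r : k}
    (hi : v i ≠ 0) (h : v i = r • v j) : Parallel M i j := by
  have indep_of_ne_zero : ∀ {e}, v e ≠ 0 → M.Indep {e} := fun he =>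
    (hM _).2 ((linearIndepOn_singleton_iff k).2 he)
  have hj : v j ≠ 0 := by
    rintro hj
    exact hi (by rw [h, hj, smul_zero])
  refine ⟨Matroid.indep_singleton.1 (indep_of_ne_zero hi), or_iff_not_imp_left.2 fun hij => ?_⟩
  rw [Matroid.isCircuit_iff_dep_forall_sdiff_singleton_indep]
  refine ⟨⟨fun hind => ?_, ?_⟩, ?_⟩
  · rw [Set.pair_comm, hM, linearIndepOn_pair_iff _ (Ne.symm hij) hj] at hind
    exact hind r h.symm
  · exact Set.pair_subset (Set.singleton_subset_iff.1 (indep_of_ne_zero hi).subset_ground)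
      (Set.singleton_subset_iff.1 (indep_of_ne_zero hj).subset_ground)
  · rintro e (rfl | rfl)
    · exact (indep_of_ne_zero hj).subset fun x hx => hx.1.resolve_left hx.2
    · exact (indep_of_ne_zero hi).subset fun x hx => hx.1.resolve_right hx.2

end Irreducible

end MilnorArrangement

end

theorem mainTheorem7_general {k : Type u} [Field k] {n : ℕ} (hn : 0 < n) {M : Matroid (Fin n)}
    (hpar : ∀ i j : Fin n, MilnorArrangement.Parallel M i j → i = j)
    {A : Submodule k (Fin n → k)}
    (hA : ∀ I : Set (Fin n), M.Indep I ↔ LinearIndepOn k (MilnorArrangement.coord A) I)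
    (w : Fin n → ℝ) :
    IsEmpty (MilnorArrangement.initialDegeneration w (MilnorArrangement.milnorTorusIdeal A)) ∨
      AlgebraicGeometry.IsIntegral
        (MilnorArrangement.initialDegeneration w (MilnorArrangement.milnorTorusIdeal A)) := by
  refine (MilnorArrangement.initialIdeal_milnorTorusIdeal_eq_top_or_isPrime hn
    (fun i j r hi h => hpar i j (MilnorArrangement.parallel_of_eq_smul hA hi h)) w).imp
      (fun htop => ?_) fun hprime => ?_
  · exact PrimeSpectrum.isEmpty_iff_subsingleton.2 (Ideal.Quotient.subsingleton_iff.2 htop)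
  · have := (Ideal.Quotient.isDomain_iff_prime _).2 hprime
    rw [MilnorArrangement.initialDegeneration]
    infer_instance

theorem mainTheorem7 {k : Type u} [Field k] [IsAlgClosed k] {d n : ℕ} (hd : 0 < d) (hn : 0 < n)
    (M : Matroid (Fin n)) (hE : M.E = Set.univ) (hrank : M.eRank = d) (hloop : M.Loopless)
    (hpar : ∀ i j : Fin n, MilnorArrangement.Parallel M i j → i = j)
    (A : Submodule k (Fin n → k)) (hA : A ∈ MilnorArrangement.GrMatroid k d M)
    (w : Fin n → ℝ) :
    IsEmpty (MilnorArrangement.initialDegeneration w (MilnorArrangement.milnorTorusIdeal A)) ∨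
      IrreducibleSpace
        (MilnorArrangement.initialDegeneration w (MilnorArrangement.milnorTorusIdeal A)) := by
  rcases mainTheorem7_general hn hpar hA.2 w with h | h
  · exact .inl h
  · exact .inr inferInstance
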